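/- Let $S$ be a locally compact Hausdorff space, with Stone–Čech compactification $\beta S\supseteq S$. Let $\mathfrak R(S)$ be the Boolean algebra of regular open subsets of $S$ (those with $R=\mathrm{int}(\mathrm{clos}(R))$), with meet $Q\cap R$, join $Q\vee R:=\mathrm{int}(\mathrm{clos}(Q\cup R))$ and complement $\neg R:=\mathrm{int}(S\setminus R)$. For $R\in\mathfrak R(S)$ let $\widehat R$ be the unique regular open subset of $\beta S$ with $\widehat R\cap S=R$. Let $\mathfrak B$ be a Boolean subalgebra of $\mathfrak R(S)$ which is *generative*, i.e. $\{\widehat B : B\in\mathfrak B\}$ is a base for the topology of $\beta S$. Let $\mu$ be a *credence* on $\mathfrak B$: a function $\mu:\mathfrak B\to[0,1]$ with $\mu[S]=1$ and $\mu[B_1\vee\dots\vee B_N]=\sum_{n=1}^N\mu[B_n]$ for every finite family of disjoint $B_1,\dots,B_N\in\mathfrak B$. *Integration.* A function $f:S\to\mathbb R$ is *simple* if there are disjoint $P_1,\dots,P_N\in\mathfrak B$ with $P_1\vee\dots\vee P_N=S$ such that $f$ is equal to a constant $r_n$ on each $P_n$; then $\int^\diamond_D f\,d\mu:=\sum_{n=1}^N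 r_n\,\mu[P_n\cap D]$ for $D\in\mathfrak B$. Let $\mathcal G_{\mathfrak B}(S)$ be the closed linear span, in the bounded continuous functions $S\to\mathbb R$ with the uniform norm, of those bounded continuous $f$ such that $\mathrm{int}(f^{-1}(-\infty,r])\in\mathfrak B$ and $\mathrm{int}(f^{-1}[r,\infty))\in\mathfrak B$ for all $r\in\mathbb R$. For $g\in\mathcal G_{\mathfrak B}(S)$ and $D\in\mathfrak B$ let $$\mathbb I^\mu_D[g]:=\sup\Big\{\int^\diamond_D f\,d\mu \;:\; f \text{ simple},\ f(s)\le g(s)\text{ for all } s\in D\Big\}.$$ *Stone space and Gleason map.* Let $S^*:=\sigma(\mathfrak B)$ be the Stone space of $\mathfrak B$, i.e. the set of all ultrafilters of $\mathfrak B$, with the topology which has the sets $B^*:=\{s^*\in S^* : B\in s^*\}$ ($B\in\mathfrak B$) as a base. The map $B\mapsto B^*$ is an isomorphism from $\mathfrak B$ onto the algebra of clopen subsets of $S^*$; let $\mu^*[B^*]:=\mu[B]$, a probability charge on the clopen subsets of $S^*$. For $s^*\in S^*$ let $p(s^*)$ be the unique element of $\bigcap_{B\in s^*}\mathrm{clos}(\widehat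 B)$; this is the generalized Gleason map $p:S^*\to\beta S$. For bounded continuous $g:S\to\mathbb R$ let $\widehat g:\beta S\to\mathbb R$ be its continuous extension. **Theorem.** There is a unique regular (Radon) Borel probability measure on $S^*$ which extends $\mu^*$. Furthermore, if $\nu$ is any Borel probability measure on $S^*$ which extends $\mu^*$ (in particular, if $\nu$ is the regular one), then for every $g\in\mathcal G_{\mathfrak B}(S)$ and every $D\in\mathfrak B$ the function $\widehat g\circ p$ is $\nu$-integrable on $D^*$ and $$\mathbb I^\mu_D[g]=\int_{D^*}\widehat g\circ p\;d\nu .$$ -/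

import Mathlib

open TopologicalSpace MeasureTheory
open scoped BoundedContinuousFunction

noncomputable section

namespace CredenceTheory

/-! ## Stone spaces of Boolean algebras -/

/-- The Stone space of a Boolean algebra `A`: the set of all ultrafilters of `A`. -/
@[ext]
structure StoneSpace (A : Type*) [BooleanAlgebra A] where
  carrier : Set A
  inf_mem : ∀ {a b : A}, a ∈ carrier → b ∈ carrier → a ⊓ b ∈ carrier
  mem_of_le : ∀ {a b : A}, a ∈ carrier → a ≤ b → b ∈ carrier
  bot_notMem : ⊥ ∉ carrier
  mem_or_compl_mem : ∀ a : A, a ∈ carrier ∨ aᶜ ∈ carrier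

namespace StoneSpace

variable {A : Type*} [BooleanAlgebra A]

/-- The set of all ultrafilters which contain `a`. -/
def star (a : A) : Set (StoneSpace A) := {U | a ∈ U.carrier}

/-- The sets `star a` generate (and in fact are a base of) the topology of the Stone space. -/
instance : TopologicalSpace (StoneSpace A) := generateFrom (Set.range star)

/-- The Stone space carries its Borel sigma-algebra. -/
instance : MeasurableSpace (StoneSpace A) := borel _

instance : BorelSpace (StoneSpace A) := ⟨rfl⟩

theorem compl_mem_iff (U : StoneSpace A) (a : A) : aᶜ ∈ U.carrier ↔ a ∉ U.carrier := by
  constructor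
  · intro h h'
    exact U.bot_notMem (by simpa using U.inf_mem h' h)
  · intro h
    exact (U.mem_or_compl_mem a).resolve_left h

theorem inf_mem_iff (U : StoneSpace A) (a b : A) :
    a ⊓ b ∈ U.carrier ↔ a ∈ U.carrier ∧ b ∈ U.carrier :=
  ⟨fun h => ⟨U.mem_of_le h inf_le_left, U.mem_of_le h inf_le_right⟩, fun h => U.inf_mem h.1 h.2⟩

theorem top_mem (U : StoneSpace A) : ⊤ ∈ U.carrier := by
  have := (U.compl_mem_iff ⊥).2 U.bot_notMem
  simpa using this

theorem star_compl (a : A) : star aᶜ = (star a)ᶜ := Set.ext fun U => U.compl_mem_iff a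

theorem star_inf (a b : A) : star (a ⊓ b) = star a ∩ star b := Set.ext fun U => U.inf_mem_iff a b

theorem star_top : star (⊤ : A) = Set.univ := Set.eq_univ_of_forall fun U => U.top_mem

theorem star_bot : star (⊥ : A) = ∅ := Set.eq_empty_of_forall_notMem fun U => U.bot_notMem

theorem star_sup (a b : A) : star (a ⊔ b) = star a ∪ star b := by
  have : a ⊔ b = (aᶜ ⊓ bᶜ)ᶜ := by simp
  rw [this, star_compl, star_inf, star_compl, star_compl, Set.compl_inter, compl_compl, compl_compl]

theorem isOpen_star (a : A) : IsOpen (star a) := isOpen_generateFrom_of_mem ⟨a, rfl⟩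

theorem isClopen_star (a : A) : IsClopen (star a) :=
  ⟨⟨by rw [← star_compl]; exact isOpen_star _⟩, isOpen_star a⟩

theorem isTopologicalBasis_star : IsTopologicalBasis (Set.range (star (A := A))) where
  exists_subset_inter := by
    rintro _ ⟨a, rfl⟩ _ ⟨b, rfl⟩ x hx
    exact ⟨star (a ⊓ b), ⟨_, rfl⟩, by rwa [star_inf], by rw [star_inf]⟩
  sUnion_eq := Set.eq_univ_of_forall fun _ => ⟨star ⊤, ⟨⊤, rfl⟩, by rw [star_top]; trivial⟩
  eq_generateFrom := rfl

instance : CompactSpace (StoneSpace A) := by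
  refine ⟨isCompact_iff_ultrafilter_le_nhds.2 fun F _ => ?_⟩
  let U : StoneSpace A :=
    { carrier := {a | star a ∈ F}
      inf_mem := fun ha hb => Filter.mem_of_superset (Filter.inter_mem ha hb)
        fun V hV => V.inf_mem hV.1 hV.2
      mem_of_le := fun ha hab => Filter.mem_of_superset ha fun V hV => V.mem_of_le hV hab
      bot_notMem := by
        change star (⊥ : A) ∉ F
        rw [star_bot]
        exact F.empty_notMem
      mem_or_compl_mem := fun a => by
        change star a ∈ F ∨ star aᶜ ∈ F
        rw [star_compl]
        exact F.mem_or_compl_mem _ }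
  refine ⟨U, trivial, ?_⟩
  rw [nhds_generateFrom]
  refine le_iInf₂ fun s hs => ?_
  obtain ⟨hU, a, rfl⟩ := hs
  exact Filter.le_principal_iff.2 hU

/-- Every non-zero element of a Boolean algebra lies in an ultrafilter. -/
theorem exists_mem_of_ne_bot {a : A} (ha : a ≠ ⊥) : ∃ U : StoneSpace A, a ∈ U.carrier := by
  obtain ⟨J, hJ, -, hd⟩ := DistribLattice.prime_ideal_of_disjoint_filter_ideal
    (F := Order.PFilter.principal a) (I := (⊥ : Order.Ideal A)) (by
      rw [Set.disjoint_left]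
      intro x hx hx'
      have h1 : a ≤ x := Order.PFilter.mem_principal.1 hx
      have h2 : x = ⊥ := le_bot_iff.1 (show x ≤ ⊥ from hx')
      exact ha (le_bot_iff.1 (h2 ▸ h1)))
  rw [Set.disjoint_left] at hd
  refine ⟨⟨{x | x ∉ J}, ?_, ?_, ?_, ?_⟩, ?_⟩
  · intro x y hx hy hxy
    exact (hJ.mem_or_mem hxy).elim hx hy
  · intro x y hx hxy hy
    exact hx (J.lower hxy hy)
  · exact fun h => h J.bot_mem
  · intro x
    by_contra h
    simp only [Set.mem_ofPred_eq, not_or, not_not] at h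
    have h1 : x ⊔ xᶜ ∈ J := Order.Ideal.sup_mem h.1 h.2
    rw [sup_compl_eq_top] at h1
    exact hd (Order.PFilter.mem_principal.2 le_top) h1
  · exact hd (Order.PFilter.mem_principal.2 le_rfl)

theorem star_subset_star {a b : A} : star a ⊆ star b ↔ a ≤ b := by
  refine ⟨fun h => ?_, fun h U hU => U.mem_of_le hU h⟩
  by_contra hab
  have hne : a ⊓ bᶜ ≠ ⊥ := fun h0 => hab (by
    rw [← sdiff_eq] at h0
    exact sdiff_eq_bot_iff.1 h0)
  obtain ⟨U, hU⟩ := exists_mem_of_ne_bot hne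
  rw [inf_mem_iff, compl_mem_iff] at hU
  exact hU.2 (h hU.1)

theorem exists_star_eq {C : Set (StoneSpace A)} (hC : IsClopen C) : ∃ a : A, star a = C := by
  refine hC.1.isCompact.induction_on (p := fun K => ∃ a : A, K ⊆ star a ∧ star a ⊆ C)
    ⟨⊥, Set.empty_subset _, by simp [star_bot]⟩ ?_ ?_ ?_ |>.imp
    fun a ha => Set.Subset.antisymm ha.2 ha.1
  · rintro s t hst ⟨a, ha, ha'⟩
    exact ⟨a, hst.trans ha, ha'⟩
  · rintro s t ⟨a, ha, ha'⟩ ⟨b, hb, hb'⟩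
    exact ⟨a ⊔ b, by rw [star_sup]; exact Set.union_subset_union ha hb,
      by rw [star_sup]; exact Set.union_subset ha' hb'⟩
  · intro x hx
    obtain ⟨_, ⟨a, rfl⟩, hxa, haC⟩ := isTopologicalBasis_star.exists_subset_of_mem_open hx hC.2
    exact ⟨star a, mem_nhdsWithin_of_mem_nhds ((isOpen_star a).mem_nhds hxa), a, subset_rfl, haC⟩

/-- The Stone representation theorem: `a ↦ star a` is an isomorphism from `A` onto the Boolean
algebra of clopen subsets of its Stone space. -/
def representation : A ≃o Clopens (StoneSpace A) where
  toEquiv := Equiv.ofBijective (fun a => (⟨star a, isClopen_star a⟩ : Clopens (StoneSpace A)))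
    ⟨fun _ _ h => le_antisymm
        (star_subset_star.1 (congrArg (fun C : Clopens _ => (C : Set (StoneSpace A))) h).subset)
        (star_subset_star.1 (congrArg (fun C : Clopens _ => (C : Set (StoneSpace A))) h).superset),
      fun C => (exists_star_eq C.isClopen).imp fun _ h => SetLike.coe_injective h⟩
  map_rel_iff' := star_subset_star

end StoneSpace

/-! ## Regular open sets

`Heyting.Regular (Opens S)` is the Boolean algebra of regular open subsets of `S`; the next three
facts spell out its elements and its operations (the meet is the intersection). -/

section Regular

variable {S : Type*} [TopologicalSpace S]

/-- The underlying set of a regular open set. -/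
abbrev rset (R : Heyting.Regular (Opens S)) : Set S := ((R : Opens S) : Set S)

theorem isRegular_iff (U : Opens S) :
    Heyting.IsRegular U ↔ interior (closure (U : Set S)) = U := by
  rw [Heyting.IsRegular, ← SetLike.coe_set_eq]
  simp [Opens.coe_compl_eq_interior_compl, interior_compl]

theorem rset_compl (R : Heyting.Regular (Opens S)) : rset Rᶜ = interior (rset R)ᶜ := by
  simp [rset, Opens.coe_compl_eq_interior_compl]

theorem rset_sup (Q R : Heyting.Regular (Opens S)) :
    rset (Q ⊔ R) = interior (closure (rset Q ∪ rset R)) := by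
  refine ((isRegular_iff _).1 (Q ⊔ R).prop).symm.trans ?_
  change interior (closure (((((Q : Opens S) ⊔ R)ᶜᶜ : Opens S)) : Set S)) = _
  simp only [Opens.coe_compl_eq_interior_compl, Opens.coe_sup, interior_compl, compl_compl,
    interior_closure_idem]

end Regular

/-! ## Credences and integration -/

section Integration

variable {S : Type*} [TopologicalSpace S] {𝔅 : BooleanSubalgebra (Heyting.Regular (Opens S))}

/-- The underlying set of an element of a Boolean algebra of regular open sets. -/
abbrev bset (B : 𝔅) : Set S := rset (B : Heyting.Regular (Opens S))

/-- A credence: a `[0,1]`-valued function which is normalized and finitely additive with respect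
to the join `⊔` of regular open sets. -/
structure IsCredence (μ : 𝔅 → ℝ) : Prop where
  nonneg : ∀ B, 0 ≤ μ B
  le_one : ∀ B, μ B ≤ 1
  map_top : μ ⊤ = 1
  additive : ∀ (N : ℕ) (B : Fin N → 𝔅), Pairwise (fun i j => Disjoint (B i) (B j)) →
    μ (Finset.univ.sup B) = ∑ n, μ (B n)

/-- A finite family of disjoint elements of `𝔅` whose join is the whole space. -/
structure IsPartition {N : ℕ} (P : Fin N → 𝔅) : Prop where
  disjoint : Pairwise fun i j => Disjoint (P i) (P j)
  sup_eq_top : Finset.univ.sup P = ⊤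

/-- `f` takes the constant value `r n` on the cell `P n`, for every `n`. -/
def IsSubordinate (f : S → ℝ) {N : ℕ} (P : Fin N → 𝔅) (r : Fin N → ℝ) : Prop :=
  ∀ n, ∀ s ∈ bset (P n), f s = r n

/-- `f` is a `𝔅`-simple function (arbitrary outside the cells of a finite partition) and
`x = ∑ n, r n * μ (P n ⊓ D)` is its integral over `D`. -/
def HasSimpleIntegral (μ : 𝔅 → ℝ) (D : 𝔅) (f : S → ℝ) (x : ℝ) : Prop :=
  ∃ (N : ℕ) (P : Fin N → 𝔅) (r : Fin N → ℝ), IsPartition P ∧ IsSubordinate f P r ∧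
    x = ∑ n, r n * μ (P n ⊓ D)

/-- The integrals over `D` of all simple functions which are at most `g` on `D`. -/
def lowerSums (μ : 𝔅 → ℝ) (D : 𝔅) (g : S → ℝ) : Set ℝ :=
  {x | ∃ f : S → ℝ, (∀ s ∈ bset D, f s ≤ g s) ∧ HasSimpleIntegral μ D f x}

/-- The integral of `g` over `D` with respect to the credence `μ`. -/
def integrator (μ : 𝔅 → ℝ) (D : 𝔅) (g : S →ᵇ ℝ) : ℝ := sSup (lowerSums μ D g)

theorem IsCredence.sum_partition {μ : 𝔅 → ℝ} (hμ : IsCredence μ) {N : ℕ} {P : Fin N → 𝔅}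
    (hP : IsPartition P) (D : 𝔅) : ∑ n, μ (P n ⊓ D) = μ D := by
  rw [← hμ.additive N (fun n => P n ⊓ D)
    fun i j hij => (hP.disjoint hij).mono inf_le_left inf_le_left]
  congr 1
  rw [← Finset.sup_inf_distrib_right, hP.sup_eq_top, top_inf_eq]

theorem IsCredence.map_bot {μ : 𝔅 → ℝ} (hμ : IsCredence μ) : μ ⊥ = 0 := by
  simpa using hμ.additive 0 Fin.elim0 (fun i => i.elim0)

theorem bset_nonempty {B : 𝔅} (h : B ≠ ⊥) : (bset B).Nonempty := by
  rw [Set.nonempty_iff_ne_empty]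
  intro h0
  exact h (Subtype.ext (Subtype.ext (SetLike.coe_injective h0)))

/-- The integral of a simple function does not depend on the partition used to compute it. -/
theorem HasSimpleIntegral.unique {μ : 𝔅 → ℝ} (hμ : IsCredence μ) {D : 𝔅} {f : S → ℝ} {x y : ℝ}
    (hx : HasSimpleIntegral μ D f x) (hy : HasSimpleIntegral μ D f y) : x = y := by
  obtain ⟨N, P, r, hP, hr, rfl⟩ := hx
  obtain ⟨M, Q, q, hQ, hq, rfl⟩ := hy
  have h1 : ∀ n, μ (P n ⊓ D) = ∑ m, μ (Q m ⊓ (P n ⊓ D)) :=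
    fun n => (hμ.sum_partition hQ _).symm
  have h2 : ∀ m, μ (Q m ⊓ D) = ∑ n, μ (Q m ⊓ (P n ⊓ D)) := by
    intro m
    rw [← hμ.sum_partition hP]
    exact Finset.sum_congr rfl fun n _ => by rw [inf_left_comm]
  simp_rw [h1, h2, Finset.mul_sum]
  rw [Finset.sum_comm]
  refine Finset.sum_congr rfl fun m _ => Finset.sum_congr rfl fun n _ => ?_
  by_cases h : Q m ⊓ (P n ⊓ D) = ⊥
  · rw [h, hμ.map_bot, mul_zero, mul_zero]
  · obtain ⟨s, hs⟩ := bset_nonempty h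
    have hs' : s ∈ bset (Q m) ∧ s ∈ bset (P n) := ⟨hs.1, hs.2.1⟩
    rw [← hr n s hs'.2, ← hq m s hs'.1]

/-- The supremum which defines the integral is a genuine one. -/
theorem isLUB_integrator {μ : 𝔅 → ℝ} (hμ : IsCredence μ) (D : 𝔅) (g : S →ᵇ ℝ) :
    IsLUB (lowerSums μ D g) (integrator μ D g) := by
  refine isLUB_csSup ?_ ⟨‖g‖ * μ D, ?_⟩
  · refine ⟨_, fun _ => -‖g‖, fun s _ => (abs_le.1 (g.norm_coe_le_norm s)).1, 1, fun _ => ⊤,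
      fun _ => -‖g‖, ⟨fun i j hij => (hij (Subsingleton.elim i j)).elim, by simp⟩,
      fun _ _ _ => rfl, rfl⟩
  · rintro _ ⟨f, hf, N, P, r, hP, hr, rfl⟩
    rw [← hμ.sum_partition hP, Finset.mul_sum]
    refine Finset.sum_le_sum fun n _ => ?_
    by_cases h : P n ⊓ D = ⊥
    · rw [h, hμ.map_bot, mul_zero, mul_zero]
    · obtain ⟨s, hs⟩ := bset_nonempty h
      have hs' : s ∈ bset (P n) ∧ s ∈ bset D := hs
      refine mul_le_mul_of_nonneg_right ?_ (hμ.nonneg _)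
      rw [← hr n s hs'.1]
      exact (hf s hs'.2).trans (abs_le.1 (g.norm_coe_le_norm s)).2

variable (𝔅) in
/-- `f` is `𝔅`-comeasurable: the interiors of the preimages of all closed half-lines are in `𝔅`.
(For continuous `f`, closed half-lines can be replaced by closures of finite unions of
intervals.) -/
def IsComeasurable (f : S → ℝ) : Prop :=
  ∀ r : ℝ, (∃ B : 𝔅, bset B = interior (f ⁻¹' Set.Iic r)) ∧
    ∃ B : 𝔅, bset B = interior (f ⁻¹' Set.Ici r)

variable (𝔅) in
/-- The closed linear span (for the uniform norm) of the bounded continuous `𝔅`-comeasurable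
functions. -/
def integrands : Submodule ℝ (S →ᵇ ℝ) :=
  (Submodule.span ℝ {f : S →ᵇ ℝ | IsComeasurable 𝔅 f}).topologicalClosure

/-- The charge on the clopen subsets of the Stone space of `𝔅` that corresponds to `μ` under the
Stone representation: it sends the clopen set of all ultrafilters containing `B` to `μ B`. -/
def stoneCharge (μ : 𝔅 → ℝ) (C : Clopens (StoneSpace 𝔅)) : ℝ :=
  μ (StoneSpace.representation.symm C)

end Integration

/-! ## The Stone–Čech compactification and the generalized Gleason map -/

section Gleason

variable {S : Type*} [TopologicalSpace S]

theorem mem_closedBall_norm (g : S →ᵇ ℝ) (s : S) : g s ∈ Metric.closedBall (0 : ℝ) ‖g‖ := by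
  rw [mem_closedBall_zero_iff]
  exact g.norm_coe_le_norm s

/-- The continuous extension to the Stone–Čech compactification of a bounded continuous function,
seen as a map into a compact ball. -/
def stoneCechExtension (g : S →ᵇ ℝ) (x : StoneCech S) : ℝ :=
  (stoneCechExtend (g.continuous.subtype_mk (mem_closedBall_norm g)) x :
    Metric.closedBall (0 : ℝ) ‖g‖)

theorem continuous_stoneCechExtension (g : S →ᵇ ℝ) : Continuous (stoneCechExtension g) :=
  continuous_subtype_val.comp
    (continuous_stoneCechExtend (g.continuous.subtype_mk (mem_closedBall_norm g)))

theorem stoneCechExtension_stoneCechUnit (g : S →ᵇ ℝ) (s : S) :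
    stoneCechExtension g (stoneCechUnit s) = g s := by
  simp [stoneCechExtension, stoneCechExtend_stoneCechUnit]


/-- Every open subset of the Stone–Čech compactification has the same closure as its trace. -/
theorem closure_image_preimage {U : Set (StoneCech S)} (hU : IsOpen U) :
    closure (stoneCechUnit '' (stoneCechUnit ⁻¹' U : Set S)) = closure U := by
  rw [Set.image_preimage_eq_inter_range]
  exact Set.Subset.antisymm (closure_mono Set.inter_subset_left)
    (closure_minimal (denseRange_stoneCechUnit.open_subset_closure_inter hU) isClosed_closure)

variable [T2Space S] [LocallyCompactSpace S]

theorem isOpenEmbedding_stoneCechUnit :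
    Topology.IsOpenEmbedding (stoneCechUnit : S → StoneCech S) := by
  have : CompletelyRegularSpace S :=
    OnePoint.isOpenEmbedding_coe.isInducing.completelyRegularSpace
  have : T35Space S := {}
  have hemb : Topology.IsEmbedding (stoneCechUnit : S → StoneCech S) := isEmbedding_stoneCechUnit
  refine ⟨hemb, isOpen_iff_mem_nhds.2 ?_⟩
  rintro _ ⟨x, rfl⟩
  obtain ⟨K, hK, hxK⟩ := exists_compact_mem_nhds x
  rw [hemb.nhds_eq_comap, Filter.mem_comap] at hxK
  obtain ⟨V, hV, hVK⟩ := hxK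
  obtain ⟨U, hUV, hU, hxU⟩ := mem_nhds_iff.1 hV
  refine Filter.mem_of_superset (hU.mem_nhds hxU) ?_
  have h1 : U ⊆ closure (U ∩ Set.range stoneCechUnit) :=
    denseRange_stoneCechUnit.open_subset_closure_inter hU
  have h2 : U ∩ Set.range stoneCechUnit ⊆ stoneCechUnit '' K := by
    rintro _ ⟨hy, y, rfl⟩
    exact ⟨y, hVK (hUV hy), rfl⟩
  have h3 : IsClosed (stoneCechUnit '' K : Set (StoneCech S)) :=
    (hK.image continuous_stoneCechUnit).isClosed
  exact (h1.trans (closure_minimal h2 h3)).trans (Set.image_subset_range _ _)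

/-- A regular open set `R` is the trace of a unique regular open subset of the Stone–Čech
compactification. -/
theorem existsUnique_extension (R : Heyting.Regular (Opens S)) :
    ∃! Q : Heyting.Regular (Opens (StoneCech S)), stoneCechUnit ⁻¹' rset Q = rset R := by
  have hι := isOpenEmbedding_stoneCechUnit (S := S)
  refine ⟨⟨⟨interior (closure (stoneCechUnit '' rset R)), isOpen_interior⟩, ?_⟩, ?_, ?_⟩
  · rw [isRegular_iff]
    exact interior_closure_idem
  · change stoneCechUnit ⁻¹' interior (closure (stoneCechUnit '' rset R)) = rset R
    rw [hι.isOpenMap.preimage_interior_eq_interior_preimage hι.continuous,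
      hι.isOpenMap.preimage_closure_eq_closure_preimage hι.continuous,
      Set.preimage_image_eq _ hι.injective]
    exact (isRegular_iff _).1 R.prop
  · intro Q hQ
    apply Subtype.ext
    apply SetLike.coe_injective
    change rset Q = interior (closure (stoneCechUnit '' rset R))
    rw [← hQ, closure_image_preimage (Q : Opens (StoneCech S)).isOpen]
    exact ((isRegular_iff _).1 Q.prop).symm

/-- The unique regular open subset of the Stone–Čech compactification with trace `R`. -/
def hat (R : Heyting.Regular (Opens S)) : Heyting.Regular (Opens (StoneCech S)) :=
  (existsUnique_extension R).choose

theorem preimage_hat (R : Heyting.Regular (Opens S)) : stoneCechUnit ⁻¹' rset (hat R) = rset R :=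
  (existsUnique_extension R).choose_spec.1

theorem closure_hat (R : Heyting.Regular (Opens S)) :
    closure (rset (hat R)) = closure (stoneCechUnit '' rset R) := by
  rw [← closure_image_preimage (hat R : Opens (StoneCech S)).isOpen, preimage_hat]

variable {𝔅 : BooleanSubalgebra (Heyting.Regular (Opens S))}

variable (𝔅) in
/-- `𝔅` is generative: the extensions of its elements are a base for the topology of the
Stone–Čech compactification. -/
def IsGenerative : Prop := IsTopologicalBasis {U : Set (StoneCech S) | ∃ B : 𝔅, U = rset (hat B.1)}

/-- For an ultrafilter in a generative algebra, the closures of the extensions of its elements have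
exactly one common point. -/
theorem IsGenerative.existsUnique (h𝔅 : IsGenerative 𝔅) (s : StoneSpace 𝔅) :
    ∃! x : StoneCech S, x ∈ ⋂ B ∈ s.carrier, closure (rset (hat (B : Heyting.Regular (Opens S)))) := by
  have hne : (⋂ B : s.carrier, closure (rset (hat B.1.1))).Nonempty := by
    have : Nonempty s.carrier := ⟨⟨⊤, s.top_mem⟩⟩
    refine IsCompact.nonempty_iInter_of_directed_nonempty_isCompact_isClosed _ ?_ ?_
      (fun _ => isClosed_closure.isCompact) (fun _ => isClosed_closure)
    · rintro ⟨B, hB⟩ ⟨C, hC⟩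
      refine ⟨⟨B ⊓ C, s.inf_mem hB hC⟩, ?_, ?_⟩
      · change closure _ ⊆ closure _
        rw [closure_hat, closure_hat]
        exact closure_mono (Set.image_mono fun x hx => hx.1)
      · change closure _ ⊆ closure _
        rw [closure_hat, closure_hat]
        exact closure_mono (Set.image_mono fun x hx => hx.2)
    · rintro ⟨B, hB⟩
      have : B ≠ ⊥ := fun h => s.bot_notMem (h ▸ hB)
      rw [closure_hat]
      exact ((bset_nonempty this).image _).closure
  obtain ⟨x, hx⟩ := hne
  rw [Set.mem_iInter] at hx
  refine ⟨x, Set.mem_iInter₂.2 fun B hB => hx ⟨B, hB⟩, fun y hy => ?_⟩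
  replace hy := Set.mem_iInter₂.1 hy
  by_contra hyx
  obtain ⟨U, V, hU, hV, hxU, hyV, hUV⟩ := t2_separation (Ne.symm hyx)
  obtain ⟨_, ⟨B, rfl⟩, hxB, hBU⟩ := h𝔅.exists_subset_of_mem_open hxU hU
  rcases s.mem_or_compl_mem B with hB | hB
  · exact (hUV.mono_left hBU).closure_left hV |>.le_bot ⟨hy B hB, hyV⟩
  · have h1 := hx ⟨Bᶜ, hB⟩
    rw [closure_hat, mem_closure_iff] at h1
    obtain ⟨_, hz, z, hzB, rfl⟩ := h1 _ (hat B.1 : Opens (StoneCech S)).isOpen hxB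
    have hz' : z ∈ rset B.1 := by rw [← preimage_hat]; exact hz
    have hzB' : z ∈ rset (B.1)ᶜ := hzB
    rw [rset_compl] at hzB'
    exact interior_subset hzB' hz'

/-- The generalized Gleason map, which sends an ultrafilter `s` to the unique common point of the
closures of the extensions of the elements of `s`. -/
def gleasonMap (h𝔅 : IsGenerative 𝔅) (s : StoneSpace 𝔅) : StoneCech S :=
  (h𝔅.existsUnique s).choose

theorem iInter_closure_hat (h𝔅 : IsGenerative 𝔅) (s : StoneSpace 𝔅) :
    ⋂ B ∈ s.carrier, closure (rset (hat (B : Heyting.Regular (Opens S)))) = {gleasonMap h𝔅 s} :=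
  Set.eq_singleton_iff_unique_mem.2 (h𝔅.existsUnique s).choose_spec

end Gleason

end CredenceTheory

end

open CredenceTheory

/-! Existence: give a compact subset of the Stone space the infimum of the charges of the clopen
sets containing it. Compact sets inside open sets can be enclosed in clopen sets still inside those
open sets (`exists_star_between`), so this is a content (`outerCharge_union`), and the regular
measure it induces agrees with the charge on clopen sets (`content_measure_star`). Uniqueness uses
the same interpolation: inner regularity reduces open sets to compact ones, hence to clopen ones
(`measure_ext`).

Integral formula: `h = ĝ ∘ p` is continuous, since `p` is (`continuous_gleasonMap`). If a simple
function lies below `g` on `D`, its value on a cell bounds `ĝ` below on the closure of the trace of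
that cell on `D`, so its integral is at most that of `h` (`lowerSums_le_setIntegral`). Conversely,
`h` is within `ε` of a constant on each cell of a finite clopen partition; every point of `S` in a
cell is the image under `p` of an ultrafilter containing that cell (`exists_gleasonMap_eq`), so the
constants lowered by `ε` give a simple function below `g` (`exists_mem_lowerSums_ge`). Both
estimates involve `ν` only through its values on clopen sets, which is why any Borel extension
works. -/

namespace CredenceTheory

open scoped NNReal ENNReal

/-! ### Separation by clopen sets in a Stone space -/

namespace StoneSpace

variable {A : Type*} [BooleanAlgebra A]

instance : T2Space (StoneSpace A) := by
  refine ⟨fun U V hUV => ?_⟩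
  have h : ∃ a, ¬(a ∈ U.carrier ↔ a ∈ V.carrier) := by
    by_contra! h
    exact hUV (StoneSpace.ext (Set.ext h))
  obtain ⟨a, ha⟩ := h
  have hd : Disjoint (star a) (star aᶜ) := by
    rw [star_compl]
    exact disjoint_compl_right
  by_cases hU : a ∈ U.carrier
  · exact ⟨star a, star aᶜ, isOpen_star _, isOpen_star _, hU,
      (V.compl_mem_iff a).2 fun hV => ha (iff_of_true hU hV), hd⟩
  · exact ⟨star aᶜ, star a, isOpen_star _, isOpen_star _, (U.compl_mem_iff a).2 hU,
      by_contra fun hV => ha (iff_of_false hU hV), hd.symm⟩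

/-- Finitely many basic clopen sets inside `W` cover `K`, and their union is again of the form `star
a`. -/
theorem exists_star_between {K W : Set (StoneSpace A)} (hK : IsCompact K) (hW : IsOpen W)
    (hKW : K ⊆ W) : ∃ a : A, K ⊆ star a ∧ star a ⊆ W := by
  refine hK.induction_on (p := fun L => ∃ a : A, L ⊆ star a ∧ star a ⊆ W)
    ⟨⊥, Set.empty_subset _, by simp [star_bot]⟩ ?_ ?_ ?_
  · rintro s t hst ⟨a, ha, ha'⟩
    exact ⟨a, hst.trans ha, ha'⟩
  · rintro s t ⟨a, ha, ha'⟩ ⟨b, hb, hb'⟩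
    exact ⟨a ⊔ b, by rw [star_sup]; exact Set.union_subset_union ha hb,
      by rw [star_sup]; exact Set.union_subset ha' hb'⟩
  · intro x hx
    obtain ⟨_, ⟨a, rfl⟩, hxa, haW⟩ :=
      isTopologicalBasis_star.exists_subset_of_mem_open (hKW hx) hW
    exact ⟨star a, mem_nhdsWithin_of_mem_nhds ((isOpen_star a).mem_nhds hxa), a, subset_rfl, haW⟩

theorem disjoint_star {a b : A} (h : Disjoint a b) : Disjoint (star a) (star b) := by
  rw [Set.disjoint_iff_inter_eq_empty, ← star_inf, h.eq_bot, star_bot]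

theorem star_finset_sup {ι : Type*} (t : Finset ι) (f : ι → A) :
    star (t.sup f) = ⋃ i ∈ t, star (f i) := by
  classical
  induction t using Finset.induction_on with
  | empty => simp [star_bot]
  | insert i t _ ih => simp [star_sup, ih]

theorem measurableSet_star (a : A) : MeasurableSet (star a) := (isOpen_star a).measurableSet

/-! ### From a finite charge to a regular Borel measure -/

section Extension

variable {m : A → ℝ≥0}

theorem monotone_of_additive (hm : ∀ a b, Disjoint a b → m (a ⊔ b) = m a + m b) : Monotone m := by
  intro a b hab
  rw [← sup_sdiff_cancel_right hab, hm _ _ disjoint_sdiff_self_right]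
  exact le_self_add

theorem sup_le_of_additive (hm : ∀ a b, Disjoint a b → m (a ⊔ b) = m a + m b) (a b : A) :
    m (a ⊔ b) ≤ m a + m b := by
  rw [← sup_sdiff_self_right, hm _ _ disjoint_sdiff_self_right]
  exact add_le_add le_rfl (monotone_of_additive hm sdiff_le)

/-- The infimum of the charges of the clopen sets that contain a given compact set. -/
noncomputable def outerCharge (m : A → ℝ≥0) (K : Set (StoneSpace A)) : ℝ≥0 := ⨅ a : {a : A // K ⊆ star a}, m a

instance (K : Set (StoneSpace A)) : Nonempty {a : A // K ⊆ star a} :=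
  ⟨⟨⊤, by simp [star_top]⟩⟩

theorem outerCharge_le {K : Set (StoneSpace A)} {a : A} (h : K ⊆ star a) : outerCharge m K ≤ m a :=
  ciInf_le (f := fun a : {a : A // K ⊆ star a} => m a) (OrderBot.bddBelow _) ⟨a, h⟩

theorem le_outerCharge {K : Set (StoneSpace A)} {x : ℝ≥0} (h : ∀ a, K ⊆ star a → x ≤ m a) :
    x ≤ outerCharge m K :=
  le_ciInf fun a => h a a.2

theorem exists_lt_outerCharge_add (K : Set (StoneSpace A)) {ε : ℝ≥0} (hε : 0 < ε) :
    ∃ a, K ⊆ star a ∧ m a < outerCharge m K + ε := by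
  obtain ⟨a, ha⟩ := exists_lt_of_ciInf_lt (lt_add_of_pos_right (outerCharge m K) hε)
  exact ⟨a, a.2, ha⟩

/-- Among the elements whose clopen sets contain `star a`, the least is `a`, so monotonicity makes
the infimum attained there. -/
theorem outerCharge_star (hm : ∀ a b, Disjoint a b → m (a ⊔ b) = m a + m b) (a : A) :
    outerCharge m (star a) = m a :=
  le_antisymm (outerCharge_le subset_rfl)
    (le_outerCharge fun _ hb => monotone_of_additive hm (star_subset_star.1 hb))

theorem outerCharge_union_le (hm : ∀ a b, Disjoint a b → m (a ⊔ b) = m a + m b)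
    (K L : Set (StoneSpace A)) : outerCharge m (K ∪ L) ≤ outerCharge m K + outerCharge m L := by
  refine le_of_forall_pos_le_add fun ε hε => ?_
  obtain ⟨a, ha, ha'⟩ := exists_lt_outerCharge_add (m := m) K (half_pos hε)
  obtain ⟨b, hb, hb'⟩ := exists_lt_outerCharge_add (m := m) L (half_pos hε)
  calc outerCharge m (K ∪ L) ≤ m (a ⊔ b) := outerCharge_le (by
        rw [star_sup]; exact Set.union_subset_union ha hb)
    _ ≤ m a + m b := sup_le_of_additive hm a b
    _ ≤ (outerCharge m K + ε / 2) + (outerCharge m L + ε / 2) := add_le_add ha'.le hb'.le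
    _ = outerCharge m K + outerCharge m L + ε := by rw [add_add_add_comm, add_halves]

/-- A clopen `star a` separates `K` from `L`. It cuts any clopen cover `c` of the union into `c ⊓
a`, which covers `K`, and `c \ a`, which covers `L`. -/
theorem outerCharge_union (hm : ∀ a b, Disjoint a b → m (a ⊔ b) = m a + m b)
    {K L : Set (StoneSpace A)} (hK : IsCompact K) (hL : IsClosed L) (hKL : Disjoint K L) :
    outerCharge m (K ∪ L) = outerCharge m K + outerCharge m L := by
  refine le_antisymm (outerCharge_union_le hm K L) (le_outerCharge fun c hc => ?_)
  obtain ⟨a, hKa, haL⟩ := exists_star_between hK hL.isOpen_compl hKL.subset_compl_right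
  rw [← sup_inf_sdiff c a, hm _ _ disjoint_inf_sdiff]
  refine add_le_add (outerCharge_le ?_) (outerCharge_le ?_)
  · rw [star_inf]
    exact Set.subset_inter (Set.subset_union_left.trans hc) hKa
  · rw [sdiff_eq, star_inf, star_compl]
    exact Set.subset_inter (Set.subset_union_right.trans hc) (Set.subset_compl_comm.1 haL)

/-- The content on the Stone space that is induced by a finite charge on the Boolean algebra. -/
noncomputable def content (hm : ∀ a b, Disjoint a b → m (a ⊔ b) = m a + m b) : Content (StoneSpace A) where
  toFun K := outerCharge m K
  mono' _ _ h := le_outerCharge fun _ ha => outerCharge_le (h.trans ha)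
  sup_disjoint' K _ h _ hL := outerCharge_union hm K.isCompact hL h
  sup_le' K L := outerCharge_union_le hm K L

/-- Openness of `star a` reduces its measure to the inner content, and compactness reduces that to
the content itself. -/
theorem content_measure_star (hm : ∀ a b, Disjoint a b → m (a ⊔ b) = m a + m b) (a : A) :
    (content hm).measure (star a) = m a := by
  rw [Content.measure_apply _ (measurableSet_star a),
    Content.outerMeasure_of_isOpen _ _ (isOpen_star a),
    Content.innerContent_of_isCompact _ (isClopen_star a).1.isCompact]
  exact congrArg _ (outerCharge_star hm a)

/-- Regular finite Borel measures on a Stone space are determined by their values on the clopen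
sets. -/
theorem measure_ext {ν ρ : Measure (StoneSpace A)} [IsFiniteMeasure ν] [ν.Regular] [ρ.Regular]
    (h : ∀ a : A, ν (star a) = ρ (star a)) : ν = ρ := by
  -- One inequality needs inner regularity of the smaller side only; it is then applied in both
  -- directions.
  have key : ∀ {ν ρ : Measure (StoneSpace A)} [ν.Regular],
      (∀ a : A, ν (star a) = ρ (star a)) → ∀ W, IsOpen W → ν W ≤ ρ W := by
    intro ν ρ _ h W hW
    rw [hW.measure_eq_iSup_isCompact]
    refine iSup₂_le fun K hKW => iSup_le fun hK => ?_
    obtain ⟨a, hKa, haW⟩ := exists_star_between hK hW hKW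
    exact (measure_mono hKa).trans ((h a).trans_le (measure_mono haW))
  have hopen : ∀ W : Set (StoneSpace A), IsOpen W → ν W = ρ W := fun W hW =>
    le_antisymm (key h W hW) (key (fun a => (h a).symm) W hW)
  exact ext_of_generate_finite {W | IsOpen W} rfl (fun s hs t ht _ => IsOpen.inter (s := s) (t := t) hs ht)
    hopen (hopen _ isOpen_univ)

end Extension

/-- A continuous function on a Stone space is uniformly approximated by functions which are
constant on the cells of a finite clopen partition. -/
theorem exists_partition_of_continuous {h : StoneSpace A → ℝ} (hh : Continuous h) {ε : ℝ}
    (hε : 0 < ε) : ∃ (N : ℕ) (P : Fin N → A) (r : Fin N → ℝ),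
      Pairwise (fun i j => Disjoint (P i) (P j)) ∧ Finset.univ.sup P = ⊤ ∧
      ∀ n, ∀ t ∈ star (P n), |h t - r n| < ε := by
  have hloc : ∀ x : StoneSpace A, ∃ a : A, x ∈ star a ∧ ∀ t ∈ star a, |h t - h x| < ε := by
    intro x
    obtain ⟨_, ⟨a, rfl⟩, hxa, ha⟩ := isTopologicalBasis_star.exists_subset_of_mem_open
      (u := h ⁻¹' Metric.ball (h x) ε) (Metric.mem_ball_self hε) (Metric.isOpen_ball.preimage hh)
    exact ⟨a, hxa, fun t ht => ha ht⟩
  choose a hxa ha using hloc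
  obtain ⟨t, ht⟩ := CompactSpace.elim_nhds_subcover (fun x => star (a x))
    fun x => (isOpen_star _).mem_nhds (hxa x)
  let e := t.equivFin.symm
  -- Disjointification shrinks each cell, so the oscillation bounds survive, and preserves the join.
  obtain ⟨P, hPle, hPsup, hPd⟩ := Fintype.exists_disjointed_le fun n => a (e n)
  refine ⟨t.card, P, fun n => h (e n), hPd, ?_,
    fun n u hu => ha _ u (star_subset_star.2 (hPle n) hu)⟩
  rw [hPsup, eq_top_iff, ← star_subset_star, star_finset_sup, star_top]
  intro x _
  have hx : x ∈ ⋃ y ∈ t, star (a y) := by rw [ht]; trivial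
  obtain ⟨y, hy, hxy⟩ := Set.mem_iUnion₂.1 hx
  exact Set.mem_iUnion₂.2 ⟨e.symm ⟨y, hy⟩, Finset.mem_univ _, by simpa using hxy⟩

end StoneSpace

/-! ### The measure on the Stone space induced by a credence -/

section Charge

variable {S : Type*} [TopologicalSpace S] {𝔅 : BooleanSubalgebra (Heyting.Regular (Opens S))}
  {μ : 𝔅 → ℝ}

theorem IsCredence.map_sup (hμ : IsCredence μ) {a b : 𝔅} (h : Disjoint a b) :
    μ (a ⊔ b) = μ a + μ b := by
  have h2 := hμ.additive 2 ![a, b] (by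
    intro i j hij
    fin_cases i <;> fin_cases j <;> first | exact absurd rfl hij | exact h | exact h.symm)
  have hs : Finset.univ.sup ![a, b] = a ⊔ b := by
    apply le_antisymm
    · refine Finset.sup_le fun i _ => ?_
      fin_cases i
      · exact le_sup_left
      · exact le_sup_right
    · exact sup_le (Finset.le_sup (f := ![a, b]) (Finset.mem_univ 0))
        (Finset.le_sup (f := ![a, b]) (Finset.mem_univ 1))
  rw [hs] at h2
  simpa [Fin.sum_univ_two] using h2

theorem stoneCharge_star (μ : 𝔅 → ℝ) (B : 𝔅) :
    stoneCharge μ ⟨StoneSpace.star B, StoneSpace.isClopen_star B⟩ = μ B :=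
  congrArg μ (StoneSpace.representation.symm_apply_apply B)

theorem extends_stoneCharge_iff {ν : Measure (StoneSpace 𝔅)} :
    (∀ C : Clopens (StoneSpace 𝔅), ν.real (C : Set (StoneSpace 𝔅)) = stoneCharge μ C) ↔
      ∀ B : 𝔅, ν.real (StoneSpace.star B) = μ B := by
  refine ⟨fun h B => (h _).trans (stoneCharge_star μ B), fun h C => ?_⟩
  obtain ⟨B, hB⟩ := StoneSpace.exists_star_eq C.isClopen
  obtain rfl : ⟨StoneSpace.star B, StoneSpace.isClopen_star B⟩ = C := SetLike.coe_injective hB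
  exact (h B).trans (stoneCharge_star μ B).symm

theorem IsCredence.existsUnique_regular_extension (hμ : IsCredence μ) :
    ∃! ν : Measure (StoneSpace 𝔅), IsProbabilityMeasure ν ∧ ν.Regular ∧
      ∀ C : Clopens (StoneSpace 𝔅), ν.real (C : Set (StoneSpace 𝔅)) = stoneCharge μ C := by
  simp_rw [extends_stoneCharge_iff]
  have hm : ∀ a b : 𝔅, Disjoint a b →
      (μ (a ⊔ b)).toNNReal = (μ a).toNNReal + (μ b).toNNReal := fun a b h => by
    rw [hμ.map_sup h, Real.toNNReal_add (hμ.nonneg a) (hμ.nonneg b)]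
  refine ⟨(StoneSpace.content (m := fun B => (μ B).toNNReal) hm).measure,
    ⟨⟨?_⟩, inferInstance, fun B => ?_⟩, ?_⟩
  · rw [← StoneSpace.star_top, StoneSpace.content_measure_star, hμ.map_top]
    simp
  · rw [Measure.real, StoneSpace.content_measure_star]
    exact Real.coe_toNNReal _ (hμ.nonneg B)
  · rintro ρ ⟨hρ, hρr, h⟩
    refine StoneSpace.measure_ext fun B => ?_
    rw [StoneSpace.content_measure_star, ← ofReal_measureReal, h B]
    rfl

/-- In `S` the cells may leave out a nowhere dense set, but in the Stone space finite joins are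
genuine unions, so nothing is lost. -/
theorem IsPartition.setIntegral_star {N : ℕ} {P : Fin N → 𝔅} (hP : IsPartition P) (D : 𝔅)
    {ν : Measure (StoneSpace 𝔅)} {h : StoneSpace 𝔅 → ℝ} (hh : Integrable h ν) :
    ∫ t in StoneSpace.star D, h t ∂ν = ∑ n, ∫ t in StoneSpace.star (P n ⊓ D), h t ∂ν := by
  rw [← integral_iUnion_fintype (fun n => StoneSpace.measurableSet_star _)
    (fun i j hij => StoneSpace.disjoint_star ((hP.disjoint hij).mono inf_le_left inf_le_left))
    (fun n => hh.integrableOn)]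
  congr 2
  simp_rw [StoneSpace.star_inf, ← Set.iUnion_inter]
  have := StoneSpace.star_finset_sup Finset.univ P
  rw [hP.sup_eq_top, StoneSpace.star_top] at this
  simp only [Finset.mem_univ, Set.iUnion_true] at this
  rw [← this, Set.univ_inter]

end Charge

/-! ### Continuity and fibres of the Gleason map -/

section GleasonIntegral

variable {S : Type*} [TopologicalSpace S] [T2Space S] [LocallyCompactSpace S]
  {𝔅 : BooleanSubalgebra (Heyting.Regular (Opens S))} (h𝔅 : IsGenerative 𝔅)

theorem gleasonMap_mem_closure {t : StoneSpace 𝔅} {B : 𝔅} (hB : B ∈ t.carrier) :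
    gleasonMap h𝔅 t ∈ closure (rset (hat (B : Heyting.Regular (Opens S)))) :=
  Set.mem_iInter₂.1 ((iInter_closure_hat h𝔅 t).superset (Set.mem_singleton _)) B hB

/-- Otherwise `Bᶜ ∈ t`, so the image point is in the closure of `Bᶜ`; its open neighbourhood `hat B`
would then contain a point of `Bᶜ`, which would lie in `B` too. -/
theorem mem_of_gleasonMap_mem {t : StoneSpace 𝔅} {B : 𝔅}
    (h : gleasonMap h𝔅 t ∈ rset (hat (B : Heyting.Regular (Opens S)))) : B ∈ t.carrier := by
  refine (t.mem_or_compl_mem B).resolve_right fun hB => ?_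
  have h1 := gleasonMap_mem_closure h𝔅 hB
  rw [closure_hat, mem_closure_iff] at h1
  obtain ⟨_, hz, z, hzB, rfl⟩ := h1 _ (hat B.1 : Opens (StoneCech S)).isOpen h
  have hz' : z ∈ rset B.1 := by rw [← preimage_hat]; exact hz
  have hzB' : z ∈ rset (B.1)ᶜ := hzB
  rw [rset_compl] at hzB'
  exact interior_subset hzB' hz'

/-- A closed neighbourhood `W` of the image point contains some basic `hat B` around it. All of
`star B` is sent into the closure of `hat B`, hence into `W`. -/
theorem continuous_gleasonMap : Continuous (gleasonMap h𝔅) := by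
  refine continuous_iff_continuousAt.2 fun t => ?_
  rw [ContinuousAt, Filter.tendsto_def]
  intro V hV
  obtain ⟨W, hW, hWc, hWV⟩ := exists_mem_nhds_isClosed_subset hV
  obtain ⟨_, ⟨B, rfl⟩, htB, hBW⟩ := h𝔅.mem_nhds_iff.1 hW
  refine Filter.mem_of_superset ((StoneSpace.isOpen_star B).mem_nhds
    (mem_of_gleasonMap_mem h𝔅 htB)) fun u hu => hWV ?_
  exact closure_minimal hBW hWc (gleasonMap_mem_closure h𝔅 hu)

/-- Every point of `S` is the image under the Gleason map of an ultrafilter that contains all the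
elements of the algebra around that point. -/
theorem exists_gleasonMap_eq (s : S) :
    ∃ t : StoneSpace 𝔅, gleasonMap h𝔅 t = stoneCechUnit s ∧ ∀ B : 𝔅, s ∈ bset B → B ∈ t.carrier := by
  -- The elements containing `s` form a filter; compactness extends it to an ultrafilter.
  have hne : (⋂ B : {B : 𝔅 // s ∈ bset B}, StoneSpace.star B.1).Nonempty := by
    have : Nonempty {B : 𝔅 // s ∈ bset B} := ⟨⟨⊤, trivial⟩⟩
    refine IsCompact.nonempty_iInter_of_directed_nonempty_isCompact_isClosed _ ?_ ?_
      (fun B => (StoneSpace.isClopen_star B.1).1.isCompact)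
      (fun B => (StoneSpace.isClopen_star B.1).1)
    · rintro ⟨B, hB⟩ ⟨C, hC⟩
      exact ⟨⟨B ⊓ C, hB, hC⟩, StoneSpace.star_subset_star.2 inf_le_left,
        StoneSpace.star_subset_star.2 inf_le_right⟩
    · rintro ⟨B, hB⟩
      refine StoneSpace.exists_mem_of_ne_bot ?_
      rintro rfl
      exact hB
  obtain ⟨t, ht⟩ := hne
  rw [Set.mem_iInter] at ht
  refine ⟨t, ?_, fun B hB => ht ⟨B, hB⟩⟩
  by_contra hne
  -- A closed neighbourhood of `s` missing the image of `t` contains some `hat B` around `s`; then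
  -- `B ∈ t` forces that image into it.
  obtain ⟨W, hW, hWc, hWV⟩ := exists_mem_nhds_isClosed_subset
    (isOpen_compl_singleton.mem_nhds (Ne.symm hne))
  obtain ⟨_, ⟨B, rfl⟩, hsB, hBW⟩ := h𝔅.mem_nhds_iff.1 hW
  have hs : s ∈ bset B := by
    change s ∈ rset B.1
    rw [← preimage_hat]
    exact hsB
  exact hWV (closure_minimal hBW hWc (gleasonMap_mem_closure h𝔅 (ht ⟨B, hs⟩))) rfl

theorem continuous_stoneCechExtension_gleasonMap (g : S →ᵇ ℝ) :
    Continuous fun t => stoneCechExtension g (gleasonMap h𝔅 t) :=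
  (continuous_stoneCechExtension g).comp (continuous_gleasonMap h𝔅)

theorem integrable_stoneCechExtension_gleasonMap (ν : Measure (StoneSpace 𝔅)) [IsFiniteMeasure ν]
    (g : S →ᵇ ℝ) : Integrable (fun t => stoneCechExtension g (gleasonMap h𝔅 t)) ν := by
  refine (BoundedContinuousFunction.mkOfCompact
    ⟨_, continuous_stoneCechExtension_gleasonMap h𝔅 g⟩).integrable ν

/-- The image of `star B` lies in the closure of `B` in the compactification, and a weak inequality
between continuous functions passes to closures. -/
theorem le_stoneCechExtension_gleasonMap {g : S →ᵇ ℝ} {B : 𝔅} {r : ℝ}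
    (h : ∀ s ∈ bset B, r ≤ g s) {t : StoneSpace 𝔅} (ht : t ∈ StoneSpace.star B) :
    r ≤ stoneCechExtension g (gleasonMap h𝔅 t) := by
  have hcl : IsClosed {x | r ≤ stoneCechExtension g x} :=
    isClosed_le continuous_const (continuous_stoneCechExtension g)
  refine closure_minimal ?_ hcl ((closure_hat B.1).subset (gleasonMap_mem_closure h𝔅 ht))
  rintro _ ⟨s, hs, rfl⟩
  change r ≤ _
  rw [stoneCechExtension_stoneCechUnit]
  exact h s hs

/-! ### Comparing lower sums with the integral over the Stone space -/

variable {μ : 𝔅 → ℝ} {ν : Measure (StoneSpace 𝔅)} [IsProbabilityMeasure ν]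

theorem lowerSums_le_setIntegral (hν : ∀ B : 𝔅, ν.real (StoneSpace.star B) = μ B) (g : S →ᵇ ℝ)
    (D : 𝔅) {x : ℝ} (hx : x ∈ lowerSums μ D g) :
    x ≤ ∫ t in StoneSpace.star D, stoneCechExtension g (gleasonMap h𝔅 t) ∂ν := by
  obtain ⟨f, hf, N, P, r, hP, hr, rfl⟩ := hx
  have hint := integrable_stoneCechExtension_gleasonMap h𝔅 ν g
  rw [hP.setIntegral_star D hint]
  refine Finset.sum_le_sum fun n _ => ?_
  rw [← hν]
  refine setIntegral_ge_of_const_le_real (StoneSpace.measurableSet_star _) (measure_ne_top _ _)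
    (fun t ht => le_stoneCechExtension_gleasonMap h𝔅 (fun s hs => ?_) ht) hint.integrableOn
  rw [← hr n s hs.1]
  exact hf s hs.2

/-- Of the error `2 * ε`, one `ε` comes from the approximation of the integrand and one from
lowering the constants below `g`; the total mass is at most one. -/
theorem exists_mem_lowerSums_ge (hν : ∀ B : 𝔅, ν.real (StoneSpace.star B) = μ B) (g : S →ᵇ ℝ)
    (D : 𝔅) {ε : ℝ} (hε : 0 < ε) :
    ∃ x ∈ lowerSums μ D g,
      ∫ t in StoneSpace.star D, stoneCechExtension g (gleasonMap h𝔅 t) ∂ν ≤ x + 2 * ε := by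
  classical
  obtain ⟨N, P, r, hPd, hPs, hr⟩ := StoneSpace.exists_partition_of_continuous
    (continuous_stoneCechExtension_gleasonMap h𝔅 g) hε
  have hP : IsPartition P := ⟨hPd, hPs⟩
  have hint := integrable_stoneCechExtension_gleasonMap h𝔅 ν g
  -- Off the cells a simple function is unconstrained, and the value `g s` makes the bound `f ≤ g`
  -- trivial there.
  let f : S → ℝ := fun s => if h : ∃ n, s ∈ bset (P n) then r h.choose - ε else g s
  have hf : ∀ s ∈ bset D, f s ≤ g s := by
    intro s _
    by_cases h : ∃ n, s ∈ bset (P n)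
    · obtain ⟨t, hts, ht⟩ := exists_gleasonMap_eq h𝔅 s
      have h1 := hr _ t (ht _ h.choose_spec)
      rw [hts, stoneCechExtension_stoneCechUnit] at h1
      simp only [f, dif_pos h]
      linarith [(abs_lt.1 h1).1]
    · exact (dif_neg h).le
  have hsub : IsSubordinate f P fun n => r n - ε := by
    intro n s hs
    have h : ∃ n, s ∈ bset (P n) := ⟨n, hs⟩
    -- Disjoint cells make the chosen index the only one.
    have hn : h.choose = n := by
      by_contra hne
      have : s ∈ bset (P h.choose ⊓ P n) := ⟨h.choose_spec, hs⟩
      rw [(hPd hne).eq_bot] at this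
      exact this
    simp only [f, dif_pos h, hn]
  refine ⟨_, ⟨f, hf, N, P, _, hP, hsub, rfl⟩, ?_⟩
  have hle : ∀ n, ∫ t in StoneSpace.star (P n ⊓ D), stoneCechExtension g (gleasonMap h𝔅 t) ∂ν ≤
      (r n + ε) * μ (P n ⊓ D) := by
    intro n
    calc _ ≤ ∫ _ in StoneSpace.star (P n ⊓ D), (r n + ε) ∂ν := by
          refine setIntegral_mono_on hint.integrableOn (integrable_const _)
            (StoneSpace.measurableSet_star _) fun t ht => ?_
          rw [StoneSpace.star_inf] at ht
          linarith [(abs_lt.1 (hr n t ht.1)).2]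
      _ = _ := by rw [setIntegral_const, hν, smul_eq_mul, mul_comm]
  -- Integrating the constant `1` over the partition identifies this sum with the mass of `star D`.
  have hone : ∑ n, μ (P n ⊓ D) ≤ 1 := by
    have := hP.setIntegral_star D (integrable_const (1 : ℝ) (μ := ν))
    simp only [setIntegral_const, hν, smul_eq_mul, mul_one] at this
    rw [← this, ← hν]
    exact measureReal_le_one
  rw [hP.setIntegral_star D hint]
  calc _ ≤ ∑ n, (r n + ε) * μ (P n ⊓ D) := Finset.sum_le_sum fun n _ => hle n
    _ = ∑ n, (r n - ε) * μ (P n ⊓ D) + 2 * ε * ∑ n, μ (P n ⊓ D) := by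
      rw [Finset.mul_sum, ← Finset.sum_add_distrib]
      exact Finset.sum_congr rfl fun n _ => by ring
    _ ≤ _ := by nlinarith

theorem integrator_eq_setIntegral (hμ : IsCredence μ)
    (hν : ∀ B : 𝔅, ν.real (StoneSpace.star B) = μ B) (g : S →ᵇ ℝ) (D : 𝔅) :
    integrator μ D g =
      ∫ t in StoneSpace.star D, stoneCechExtension g (gleasonMap h𝔅 t) ∂ν := by
  have hlub := isLUB_integrator hμ D g
  refine le_antisymm (hlub.2 fun x hx => lowerSums_le_setIntegral h𝔅 hν g D hx)
    (le_of_forall_pos_le_add fun ε hε => ?_)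
  obtain ⟨x, hx, hle⟩ := exists_mem_lowerSums_ge h𝔅 hν g D (half_pos hε)
  linarith [hlub.1 hx]

end GleasonIntegral

end CredenceTheory

theorem mainTheorem5 {S : Type*} [TopologicalSpace S] [T2Space S] [LocallyCompactSpace S]
    (𝔅 : BooleanSubalgebra (Heyting.Regular (Opens S))) (h𝔅 : IsGenerative 𝔅)
    (μ : 𝔅 → ℝ) (hμ : IsCredence μ) :
    (∃! ν : Measure (StoneSpace 𝔅), IsProbabilityMeasure ν ∧ ν.Regular ∧
      ∀ C : Clopens (StoneSpace 𝔅), ν.real (C : Set (StoneSpace 𝔅)) = stoneCharge μ C) ∧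
    ∀ ν : Measure (StoneSpace 𝔅), IsProbabilityMeasure ν →
      (∀ C : Clopens (StoneSpace 𝔅), ν.real (C : Set (StoneSpace 𝔅)) = stoneCharge μ C) →
      ∀ g ∈ integrands 𝔅, ∀ D : 𝔅,
        IntegrableOn (fun s => stoneCechExtension g (gleasonMap h𝔅 s)) (StoneSpace.star D) ν ∧
        integrator μ D g =
          ∫ s in StoneSpace.star D, stoneCechExtension g (gleasonMap h𝔅 s) ∂ν := by
  refine ⟨hμ.existsUnique_regular_extension, fun ν hν hνμ g _ D => ?_⟩
  exact ⟨(integrable_stoneCechExtension_gleasonMap h𝔅 ν g).integrableOn,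
    integrator_eq_setIntegral h𝔅 hμ (extends_stoneCharge_iff.1 hνμ) g D⟩
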